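/- There is an absolute constant $C>0$ such that the following holds. Let $n\ge 0$ be an integer, let $X$ be a random variable with values in $\{0,1\}^n$, and let $k,\delta,\varepsilon$ be real numbers with $\delta>0$ and $0<\varepsilon\le\delta/2$. Write $P_Z(x)=\Pr[Z=x]$ and $\mathrm H_\infty(Z)=-\log_2\max_x P_Z(x)$ for random variables $Z$ over $\{0,1\}^n$. Suppose that the $\delta$-smooth min-entropy of $X$ is below $k$: $$\mathrm H_\infty^{\delta}(X)=\max\Big\{\mathrm H_\infty(Y)\;:\;\sum_{x}|P_X(x)-P_Y(x)|\le\delta\Big\}<k .$$ Put $$s=C\,n\,\max\big(1,\;2^k\varepsilon^2\delta^{-2}\big).$$ Then the HILL pseudoentropy of $X$ of quality $(s,\varepsilon)$ is below $k$: $$\mathrm H^{\mathrm{HILL}}_{s,\varepsilon}(X)=\max\{\mathrm H_\infty(Y)\;:\;|\Pr[D(X)=1]-\Pr[D(Y)=1]|\le\varepsilon\text{ for every circuit }D\text{ of size at most }s\}<k .$$ In particular, for every $Y$ over $\{0,1\}^n$ with $\mathrm H_\infty(Y)\ge k$ there is a circuit $D$ of size at most $s$ with $|\Pr[D(X)=1]-\Pr[D(Y)=1]|>\varepsilon$.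 Here a circuit is a Boolean circuit with $n$ inputs and one output, with gates AND and OR of fan-in two, NOT, and constants, and arbitrary fan-out; its size is the number of its gates. -/

import Mathlib

namespace Pseudoentropy

/-- A gate whose inputs are chosen among `m` available wires. -/
inductive Gate (m : ℕ) : Type
  | const (b : Bool) : Gate m
  | not (i : Fin m) : Gate m
  | and (i j : Fin m) : Gate m
  | or (i j : Fin m) : Gate m

/-- The value of a gate, given the values of the available wires. -/
def Gate.eval {m : ℕ} (v : Fin m → Bool) : Gate m → Bool
  | .const b => b
  | .not i => !(v i)
  | .and i j => v i && v j
  | .or i j => v i || v j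

/-- A sequence of `s` gates on `n` input wires. Each gate reads input wires or outputs of earlier
gates, with unbounded fan-out. -/
inductive GateSeq (n : ℕ) : ℕ → Type
  | nil : GateSeq n 0
  | snoc {s : ℕ} (c : GateSeq n s) (g : Gate (n + s)) : GateSeq n (s + 1)

/-- The values of all wires (the inputs first, then the gates in order) on input `x`. -/
def GateSeq.wires {n : ℕ} (x : Fin n → Bool) : {s : ℕ} → GateSeq n s → Fin (n + s) → Bool
  | _, .nil => x
  | _, .snoc c g => Fin.snoc (α := fun _ => Bool) (c.wires x) (g.eval (c.wires x))

/-- Boolean circuits with `n` inputs and one output, over the basis AND, OR (fan-in two), NOT and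
constants. The size is the number of gates. -/
structure Circuit (n : ℕ) : Type where
  size : ℕ
  gates : GateSeq n size
  output : Fin (n + size)

/-- The Boolean function computed by a circuit. -/
def Circuit.eval {n : ℕ} (D : Circuit n) (x : Fin n → Bool) : Bool :=
  D.gates.wires x D.output

noncomputable section

/-- `Pr[D(X) = 1]`. -/
def acceptProb {n : ℕ} (D : Circuit n) (X : PMF (Fin n → Bool)) : ℝ :=
  ∑ x : Fin n → Bool, if D.eval x = true then (X x).toReal else 0

/-- The advantage `|Pr[D(X) = 1] - Pr[D(Y) = 1]|` of a circuit. -/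
def advantage {n : ℕ} (D : Circuit n) (X Y : PMF (Fin n → Bool)) : ℝ :=
  |acceptProb D X - acceptProb D Y|

/-- `(s, ε)`-indistinguishability. -/
def Indistinguishable {n : ℕ} (s ε : ℝ) (X Y : PMF (Fin n → Bool)) : Prop :=
  ∀ D : Circuit n, (D.size : ℝ) ≤ s → advantage D X Y ≤ ε

/-- The distance `d₁(X; Y) = ∑ₓ |P_X(x) - P_Y(x)|` (without a factor `1 / 2`). -/
def d1 {n : ℕ} (X Y : PMF (Fin n → Bool)) : ℝ :=
  ∑ x : Fin n → Bool, |(X x).toReal - (Y x).toReal|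

/-- Min-entropy `-log₂ maxₓ Pr[X = x]`. -/
def minEntropy {n : ℕ} (X : PMF (Fin n → Bool)) : ℝ :=
  -Real.logb 2 (⨆ x : Fin n → Bool, (X x).toReal)

/-- `δ`-smooth min-entropy: the largest min-entropy of a `Y` with `d₁(X; Y) ≤ δ`. For `δ ≥ 0` the
set is non-empty (take `Y = X`) and bounded above by `n`. -/
def smoothMinEntropy {n : ℕ} (δ : ℝ) (X : PMF (Fin n → Bool)) : ℝ :=
  sSup (minEntropy '' {Y : PMF (Fin n → Bool) | d1 X Y ≤ δ})

/-- HILL pseudoentropy of quality `(s, ε)`: the largest min-entropy of a `Y` that is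
`(s, ε)`-indistinguishable from `X`. For `ε ≥ 0` the set is non-empty (take `Y = X`) and bounded
above by `n`. -/
def hillEntropy {n : ℕ} (s ε : ℝ) (X : PMF (Fin n → Bool)) : ℝ :=
  sSup (minEntropy '' {Y : PMF (Fin n → Bool) | Indistinguishable s ε X Y})

end

end Pseudoentropy

/-! Let `S` be the set of points where `X` has mass above `2 ^ (-k)`, so `|S| ≤ 2 ^ k`. If the
excess of `X` over that height were at most `δ / 2`, spreading it over the free room would give a
`Z` of min-entropy at least `k` within `δ` of `X`. Hence `D = P_X - P_Y` has sum above `δ / 2` on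
`S` (`lt_sum_toReal_sub_toReal`). If `δ < 4 * ε`, the indicator of `S` distinguishes and is small
enough. Otherwise a smaller advantage suffices and is traded for size. By Parseval and
Cauchy-Schwarz, some signed character gains at least `1 / √q` of the sum of `D` over `q` points.
Cutting the cube into cells that each contain at most `q ≈ (δ / (4 * ε)) ^ 2` points of `S`, with a
character on each cell, yields a decision list of about `|S| / q` linear-size pieces with
correlation above `2 * ε` (`exists_costFrom_sum_div_sqrt_le_of_card_le_mul`). -/

namespace Pseudoentropy

/-! ### Circuit cost calculus -/

variable {n : ℕ}

/-- The Boolean functions computed at the wires of a gate sequence. -/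
def GateSeq.functions {s : ℕ} (c : GateSeq n s) : Set ((Fin n → Bool) → Bool) :=
  Set.range fun i x => c.wires x i

theorem GateSeq.functions_subset_snoc {s : ℕ} (c : GateSeq n s) (g : Gate (n + s)) :
    c.functions ⊆ (c.snoc g).functions := by
  rintro _ ⟨i, rfl⟩
  refine ⟨Fin.castSucc i, ?_⟩
  funext x
  exact Fin.snoc_castSucc (α := fun _ => Bool) _ _ i

theorem GateSeq.eval_mem_functions_snoc {s : ℕ} (c : GateSeq n s) (g : Gate (n + s)) :
    (fun x => g.eval (c.wires x)) ∈ (c.snoc g).functions := by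
  refine ⟨Fin.last (n + s), ?_⟩
  funext x
  exact Fin.snoc_last (α := fun _ => Bool) _ _

theorem GateSeq.input_mem_functions (i : Fin n) :
    ∀ {s : ℕ} (c : GateSeq n s), (fun x => x i) ∈ c.functions
  | _, .nil => ⟨i, rfl⟩
  | _, .snoc c g => c.functions_subset_snoc g (c.input_mem_functions i)

/-- Once the functions in `F` are available, `f` can be computed with at most `r` more gates. -/
def CostFrom (F : Set ((Fin n → Bool) → Bool)) (f : (Fin n → Bool) → Bool) (r : ℕ) : Prop :=
  ∀ ⦃s : ℕ⦄ (c : GateSeq n s), F ⊆ c.functions →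
    ∃ t ≤ s + r, ∃ c' : GateSeq n t, c.functions ⊆ c'.functions ∧ f ∈ c'.functions

namespace CostFrom

variable {F : Set ((Fin n → Bool) → Bool)} {f g h : (Fin n → Bool) → Bool} {r r' r'' : ℕ}

theorem of_mem (hf : f ∈ F) : CostFrom F f 0 :=
  fun s c hc => ⟨s, le_rfl, c, subset_rfl, hc hf⟩

theorem input (i : Fin n) : CostFrom F (fun x => x i) 0 :=
  fun s c _ => ⟨s, le_rfl, c, subset_rfl, c.input_mem_functions i⟩

theorem mono {F' : Set ((Fin n → Bool) → Bool)} (hf : CostFrom F f r) (hF : F ⊆ F')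
    (hr : r ≤ r') : CostFrom F' f r' := by
  intro s c hc
  obtain ⟨t, ht, c', h⟩ := hf c (hF.trans hc)
  exact ⟨t, by omega, c', h⟩

/-- Old wires persist, so the gates for `f` are paid for once however often `g` reads it. -/
theorem trans (hf : CostFrom F f r) (hg : CostFrom (insert f F) g r') :
    CostFrom F g (r + r') := by
  intro s c hc
  obtain ⟨t, ht, c₁, h₁, h₂⟩ := hf c hc
  obtain ⟨u, hu, c₂, h₃, h₄⟩ := hg c₁ (Set.insert_subset h₂ (hc.trans h₁))
  exact ⟨u, by omega, c₂, h₁.trans h₃, h₄⟩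

theorem const (b : Bool) : CostFrom F (fun _ => b) 1 :=
  fun _ c _ => ⟨_, le_rfl, c.snoc (.const b), c.functions_subset_snoc _,
    c.eval_mem_functions_snoc _⟩

theorem not_of_mem (hf : f ∈ F) : CostFrom F (fun x => !f x) 1 := by
  intro s c hc
  obtain ⟨i, rfl⟩ := hc hf
  exact ⟨_, le_rfl, c.snoc (.not i), c.functions_subset_snoc _, c.eval_mem_functions_snoc _⟩

theorem and_of_mem (hf : f ∈ F) (hg : g ∈ F) : CostFrom F (fun x => f x && g x) 1 := by
  intro s c hc
  obtain ⟨i, rfl⟩ := hc hf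
  obtain ⟨j, rfl⟩ := hc hg
  exact ⟨_, le_rfl, c.snoc (.and i j), c.functions_subset_snoc _, c.eval_mem_functions_snoc _⟩

theorem or_of_mem (hf : f ∈ F) (hg : g ∈ F) : CostFrom F (fun x => f x || g x) 1 := by
  intro s c hc
  obtain ⟨i, rfl⟩ := hc hf
  obtain ⟨j, rfl⟩ := hc hg
  exact ⟨_, le_rfl, c.snoc (.or i j), c.functions_subset_snoc _, c.eval_mem_functions_snoc _⟩

theorem trans₂ (hf : CostFrom F f r) (hg : CostFrom F g r')
    (hh : CostFrom (insert g (insert f F)) h r'') : CostFrom F h (r + r' + r'') :=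
  (hf.trans ((hg.mono (Set.subset_insert _ _) le_rfl).trans hh)).mono subset_rfl (by omega)

theorem not (hf : CostFrom F f r) : CostFrom F (fun x => !f x) (r + 1) :=
  hf.trans (not_of_mem (by simp))

theorem and (hf : CostFrom F f r) (hg : CostFrom F g r') :
    CostFrom F (fun x => f x && g x) (r + r' + 1) :=
  hf.trans₂ hg (and_of_mem (by simp) (by simp))

theorem or (hf : CostFrom F f r) (hg : CostFrom F g r') :
    CostFrom F (fun x => f x || g x) (r + r' + 1) :=
  hf.trans₂ hg (or_of_mem (by simp) (by simp))

theorem beq (hf : CostFrom F f r) (hg : CostFrom F g r') :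
    CostFrom F (fun x => f x == g x) (r + r' + 4) := by
  have key : CostFrom (insert g (insert f F)) (fun x => (f x && g x) || !(f x || g x)) 4 :=
    ((of_mem (by simp)).and (of_mem (by simp))).or ((of_mem (by simp)).or (of_mem (by simp))).not
  have h : (fun x => f x == g x) = fun x => (f x && g x) || !(f x || g x) := by
    funext x
    cases f x <;> cases g x <;> rfl
  rw [h]
  exact hf.trans₂ hg key

theorem ite (hf : CostFrom F f r) (hg : CostFrom F g r') (hh : CostFrom F h r'') :
    CostFrom F (fun x => if f x then g x else h x) (r + r' + r'' + 4) := by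
  have key : CostFrom (insert f F) (fun x => (f x && g x) || (!f x && h x))
      (r' + r'' + 4) :=
    (((of_mem (by simp)).and (hg.mono (Set.subset_insert _ _) le_rfl)).or
      ((of_mem (by simp)).not.and (hh.mono (Set.subset_insert _ _) le_rfl))).mono
        subset_rfl (by omega)
  have h : (fun x => if f x then g x else h x) = fun x => (f x && g x) || (!f x && h x) := by
    funext x
    cases f x <;> simp
  rw [h]
  exact (hf.trans key).mono subset_rfl (by omega)

theorem exists_circuit (hf : CostFrom ∅ f r) : ∃ D : Circuit n, D.size ≤ r ∧ D.eval = f := by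
  obtain ⟨t, ht, c, -, i, hi⟩ := hf .nil (Set.empty_subset _)
  exact ⟨⟨t, c, i⟩, by simpa using ht, hi⟩

end CostFrom

/-! ### Cutting point sets by small circuits -/

/-- A set of Boolean vectors that agree outside `J` can be cut at any prescribed cardinality by a
function with linear circuit size. -/
theorem exists_card_filter_eq (J : Finset (Fin n)) :
    ∀ (S : Finset (Fin n → Bool)) (r : ℕ), r ≤ S.card →
      (∀ x ∈ S, ∀ y ∈ S, ∀ i ∉ J, x i = y i) →
      ∃ A : (Fin n → Bool) → Bool, CostFrom ∅ A (2 * J.card + 1) ∧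
        (S.filter fun x => A x = true).card = r := by
  induction J using Finset.induction_on with
  | empty =>
    intro S r hr hS
    have hcard : S.card ≤ 1 := Finset.card_le_one.2 fun x hx y hy =>
      funext fun i => hS x hx y hy i (Finset.notMem_empty i)
    rcases Nat.eq_zero_or_pos r with rfl | hpos
    · exact ⟨fun _ => false, CostFrom.const _, by simp⟩
    · exact ⟨fun _ => true, CostFrom.const _, by simp; omega⟩
  | insert m J hm ih =>
    intro S r hr hS
    have hagree : ∀ b : Bool, ∀ x ∈ S.filter (fun x => x m = b),
        ∀ y ∈ S.filter (fun x => x m = b), ∀ i ∉ J, x i = y i := by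
      intro b x hx y hy i hi
      rw [Finset.mem_filter] at hx hy
      by_cases him : i = m
      · rw [him, hx.2, hy.2]
      · exact hS x hx.1 y hy.1 i (by simp [him, hi])
    have hsplit : (S.filter fun x => x m = false).card + (S.filter fun x => x m = true).card
        = S.card := by
      rw [← Finset.card_filter_add_card_filter_not (s := S) (fun x => x m = false)]
      simp
    have hJ : (insert m J).card = J.card + 1 := Finset.card_insert_of_notMem hm
    -- Only the half containing the cut is refined; the other is wholly rejected or wholly kept. One
    -- recursive call per coordinate keeps the cost linear.
    by_cases hr' : r ≤ (S.filter fun x => x m = false).card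
    · obtain ⟨A, hA, hc⟩ := ih _ r hr' (hagree false)
      refine ⟨fun x => !x m && A x, ((CostFrom.input m).not.and hA).mono subset_rfl (by omega), ?_⟩
      rw [← hc, Finset.filter_filter]
      simp
    · obtain ⟨A, hA, hc⟩ := ih (S.filter fun x => x m = true)
        (r - (S.filter fun x => x m = false).card) (by omega) (hagree true)
      refine ⟨fun x => !x m || A x, ((CostFrom.input m).not.or hA).mono subset_rfl (by omega), ?_⟩
      have h : (S.filter fun x => (!x m || A x) = true) =
          (S.filter fun x => x m = false) ∪ ((S.filter fun x => x m = true).filter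
            fun x => A x = true) := by
        ext x
        cases hx : x m <;> simp [hx]
      rw [h, Finset.card_union_of_disjoint, hc]
      · omega
      · rw [Finset.disjoint_left]
        intro x hx hx'
        simp_all

/-! ### Fourier analysis on the cube -/

/-- The sign `1` for `true` and `-1` for `false`. -/
def sign (b : Bool) : ℝ := if b then 1 else -1

theorem sign_beq (a b : Bool) : sign (a == b) = sign a * sign b := by
  cases a <;> cases b <;> simp [sign]

/-- Signed characters of the cube have linear circuit size. -/
theorem exists_costFrom_sign_eq_prod (b : Bool) (a : Finset (Fin n)) :
    ∃ f : (Fin n → Bool) → Bool, CostFrom ∅ f (4 * a.card + 1) ∧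
      ∀ x, sign (f x) = sign b * ∏ i ∈ a, sign (x i) := by
  induction a using Finset.induction_on with
  | empty => exact ⟨fun _ => b, CostFrom.const b, by simp⟩
  | insert i a hi ih =>
    obtain ⟨f, hf, hfx⟩ := ih
    refine ⟨fun x => x i == f x, ((CostFrom.input i).beq hf).mono subset_rfl ?_, fun x => ?_⟩
    · rw [Finset.card_insert_of_notMem hi]
      omega
    · rw [sign_beq, hfx, Finset.prod_insert hi]
      ring

/-- The sum factors as `∏ (1 + x_i y_i)` in signs; a coordinate where `x` and `y` differ contributes
the factor `0`. -/
theorem sum_prod_sign_mul_prod_sign (x y : Fin n → Bool) :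
    ∑ a : Finset (Fin n), (∏ i ∈ a, sign (x i)) * ∏ i ∈ a, sign (y i) =
      if x = y then 2 ^ n else 0 := by
  have h : ∑ a : Finset (Fin n), (∏ i ∈ a, sign (x i)) * ∏ i ∈ a, sign (y i) =
      ∏ i, (1 + sign (x i) * sign (y i)) := by
    rw [Finset.prod_one_add]
    simp [Finset.prod_mul_distrib]
  rw [h]
  split_ifs with hxy
  · subst hxy
    have : ∀ i, 1 + sign (x i) * sign (x i) = 2 := fun i => by
      cases x i <;> norm_num [sign]
    simp [this]
  · obtain ⟨i, hi⟩ := Function.ne_iff.1 hxy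
    refine Finset.prod_eq_zero (Finset.mem_univ i) ?_
    revert hi
    cases x i <;> cases y i <;> simp [sign]

/-- Parseval's identity on the cube. -/
theorem sum_sq_sum_mul_prod_sign (D : (Fin n → Bool) → ℝ) :
    ∑ a : Finset (Fin n), (∑ x, D x * ∏ i ∈ a, sign (x i)) ^ 2 = 2 ^ n * ∑ x, D x ^ 2 := by
  calc ∑ a : Finset (Fin n), (∑ x, D x * ∏ i ∈ a, sign (x i)) ^ 2
      = ∑ a : Finset (Fin n), ∑ x, ∑ y,
          D x * D y * ((∏ i ∈ a, sign (x i)) * ∏ i ∈ a, sign (y i)) := by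
        refine Finset.sum_congr rfl fun a _ => ?_
        rw [sq, Finset.sum_mul_sum]
        refine Finset.sum_congr rfl fun x _ => Finset.sum_congr rfl fun y _ => ?_
        ring
    _ = ∑ x, ∑ y, D x * D y * ∑ a : Finset (Fin n),
          (∏ i ∈ a, sign (x i)) * ∏ i ∈ a, sign (y i) := by
        rw [Finset.sum_comm]
        refine Finset.sum_congr rfl fun x _ => ?_
        rw [Finset.sum_comm]
        simp only [Finset.mul_sum]
    _ = 2 ^ n * ∑ x, D x ^ 2 := by
        simp only [sum_prod_sign_mul_prod_sign, Finset.mul_sum]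
        refine Finset.sum_congr rfl fun x _ => ?_
        simp
        ring

/-- Parseval averaged over the `2 ^ n` characters. -/
theorem exists_sum_sq_le_sq_sum_mul_prod_sign (D : (Fin n → Bool) → ℝ) :
    ∃ a : Finset (Fin n), ∑ x, D x ^ 2 ≤ (∑ x, D x * ∏ i ∈ a, sign (x i)) ^ 2 := by
  by_contra! h
  have hlt := Finset.sum_lt_sum_of_nonempty (s := Finset.univ) Finset.univ_nonempty
    fun a _ => h a
  rw [sum_sq_sum_mul_prod_sign] at hlt
  simp at hlt

/-- A signed character correlates with `D` at least as much as the average of `D` over a set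
rescaled by the square root of its cardinality. -/
theorem exists_costFrom_sum_div_sqrt_le (D : (Fin n → Bool) → ℝ) (S : Finset (Fin n → Bool))
    {q : ℕ} (hq : 0 < q) (hS : S.card ≤ q) :
    ∃ f : (Fin n → Bool) → Bool, CostFrom ∅ f (4 * n + 1) ∧
      (∑ x ∈ S, D x) / √q ≤ ∑ x, D x * sign (f x) := by
  obtain ⟨a, ha⟩ := exists_sum_sq_le_sq_sum_mul_prod_sign D
  set z := ∑ x, D x * ∏ i ∈ a, sign (x i) with hz
  obtain ⟨f, hf, hfx⟩ := exists_costFrom_sign_eq_prod (decide (0 ≤ z)) a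
  refine ⟨f, hf.mono subset_rfl ?_, ?_⟩
  · have := Finset.card_le_univ a
    rw [Fintype.card_fin] at this
    omega
  have hsum : ∑ x, D x * sign (f x) = |z| := by
    have : ∑ x, D x * sign (f x) = sign (decide (0 ≤ z)) * z := by
      rw [hz, Finset.mul_sum]
      refine Finset.sum_congr rfl fun x _ => ?_
      rw [hfx]
      ring
    rw [this]
    by_cases h0 : 0 ≤ z
    · simp [sign, h0, abs_of_nonneg h0]
    · simp [sign, h0, abs_of_neg (not_le.1 h0)]
  rw [hsum, div_le_iff₀ (by positivity)]
  refine le_of_abs_le (abs_le_of_sq_le_sq ?_ (by positivity))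
  rw [mul_pow, sq_abs, Real.sq_sqrt (by positivity)]
  calc (∑ x ∈ S, D x) ^ 2 ≤ S.card * ∑ x ∈ S, D x ^ 2 := sq_sum_le_card_mul_sum_sq
    _ ≤ q * ∑ x, D x ^ 2 := by
        gcongr
        exact Finset.subset_univ S
    _ ≤ q * z ^ 2 := by gcongr
    _ = z ^ 2 * q := mul_comm _ _

/-! ### Circuits for decision lists and for finite sets -/

/-- Decision lists of `m` signed characters. -/
theorem exists_costFrom_sum_div_sqrt_le_of_card_le_mul {q : ℕ} (hq : 0 < q) (m : ℕ) :
    ∀ (D : (Fin n → Bool) → ℝ) (S : Finset (Fin n → Bool)), S.card ≤ m * q →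
      ∃ f : (Fin n → Bool) → Bool, CostFrom ∅ f (m * (6 * n + 6) + 1) ∧
        (∑ x ∈ S, D x) / √q ≤ ∑ x, D x * sign (f x) := by
  induction m with
  | zero =>
    intro D S hS
    have hS' : S = ∅ := by simpa using hS
    subst hS'
    -- The last default only has to avoid a negative contribution.
    refine ⟨fun _ => decide (0 ≤ ∑ x, D x), (CostFrom.const _).mono subset_rfl (by simp), ?_⟩
    rw [← Finset.sum_mul]
    by_cases h : 0 ≤ ∑ x, D x
    · simp [sign, h]
    · simp [sign, h, (not_le.1 h).le]
  | succ m ih =>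
    intro D S hS
    obtain ⟨A, hA, hcard⟩ := exists_card_filter_eq Finset.univ S (min q S.card)
      (min_le_right _ _) (by simp)
    -- `D` is restricted to the whole cell of `A`, so the circuit need not recognise `S`: points of
    -- the cell outside `S` only increase the sum of squares.
    obtain ⟨p, hp, hpD⟩ := exists_costFrom_sum_div_sqrt_le (fun x => if A x then D x else 0)
      (S.filter fun x => A x = true) hq (by omega)
    have hsplit := Finset.card_filter_add_card_filter_not (s := S) (fun x => A x = true)
    obtain ⟨f, hf, hfD⟩ := ih (fun x => if A x then 0 else D x)
      (S.filter fun x => ¬A x = true) (by rw [Nat.succ_mul] at hS; omega)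
    refine ⟨_, (hA.ite hp hf).mono subset_rfl ?_, ?_⟩
    · rw [Finset.card_univ, Fintype.card_fin]
      ring_nf
      omega
    · have h₁ : ∑ x ∈ S.filter (fun x => A x = true), (if A x then D x else 0) =
          ∑ x ∈ S.filter (fun x => A x = true), D x :=
        Finset.sum_congr rfl fun x hx => if_pos (Finset.mem_filter.1 hx).2
      have h₂ : ∑ x ∈ S.filter (fun x => ¬A x = true), (if A x then 0 else D x) =
          ∑ x ∈ S.filter (fun x => ¬A x = true), D x :=
        Finset.sum_congr rfl fun x hx => if_neg (Finset.mem_filter.1 hx).2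
      rw [h₁] at hpD
      rw [h₂] at hfD
      rw [← Finset.sum_filter_add_sum_filter_not S (fun x => A x = true), add_div]
      refine (add_le_add hpD hfD).trans_eq ?_
      rw [← Finset.sum_add_distrib]
      refine Finset.sum_congr rfl fun x _ => ?_
      by_cases hx : A x = true <;> simp [hx]

theorem costFrom_forall_eq (y : Fin n → Bool) (J : Finset (Fin n)) :
    CostFrom ∅ (fun x => decide (∀ i ∈ J, x i = y i)) (2 * J.card + 1) := by
  induction J using Finset.induction_on with
  | empty => simpa using CostFrom.const (n := n) (F := ∅) true
  | insert j J hj ih =>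
    have hlit : CostFrom ∅ (fun x : Fin n → Bool => decide (x j = y j)) 1 := by
      cases hy : y j
      · simpa using (CostFrom.input (F := ∅) j).not
      · simpa using (CostFrom.input (F := ∅) j).mono subset_rfl (Nat.zero_le 1)
    have h := hlit.and ih
    simp only [Finset.forall_mem_insert, Bool.decide_and]
    exact h.mono subset_rfl (by rw [Finset.card_insert_of_notMem hj]; omega)

theorem costFrom_decide_mem (S : Finset (Fin n → Bool)) :
    CostFrom ∅ (fun x => decide (x ∈ S)) (S.card * (2 * n + 2) + 1) := by
  induction S using Finset.induction_on with
  | empty => simpa using CostFrom.const (n := n) (F := ∅) false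
  | insert y S hy ih =>
    have h := (costFrom_forall_eq y Finset.univ).or ih
    have heq : (fun x => decide (x ∈ insert y S)) =
        fun x => decide (∀ i ∈ Finset.univ, x i = y i) || decide (x ∈ S) := by
      funext x
      simp [funext_iff]
    rw [heq]
    refine h.mono subset_rfl ?_
    rw [Finset.card_insert_of_notMem hy, Finset.card_univ, Fintype.card_fin]
    ring_nf
    omega

/-! ### Min-entropy, smoothing and the heavy part -/

theorem sum_toReal_eq_one (X : PMF (Fin n → Bool)) : ∑ x, (X x).toReal = 1 := by
  rw [← ENNReal.toReal_sum fun x _ => X.apply_ne_top x, ← tsum_fintype (L := .unconditional _),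
    X.tsum_coe, ENNReal.toReal_one]

theorem toReal_le_iSup (X : PMF (Fin n → Bool)) (x : Fin n → Bool) :
    (X x).toReal ≤ ⨆ y, (X y).toReal :=
  le_ciSup (f := fun y => (X y).toReal) (Set.finite_range _).bddAbove x

theorem inv_two_pow_le_iSup (X : PMF (Fin n → Bool)) :
    ((2 : ℝ) ^ n)⁻¹ ≤ ⨆ x, (X x).toReal := by
  have h := Finset.sum_le_sum fun x (_ : x ∈ Finset.univ) => toReal_le_iSup X x
  rw [sum_toReal_eq_one] at h
  simp only [Finset.sum_const, Finset.card_univ, Fintype.card_pi, Fintype.card_bool,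
    Finset.prod_const, Fintype.card_fin, nsmul_eq_mul, Nat.cast_pow, Nat.cast_ofNat] at h
  rwa [inv_le_iff_one_le_mul₀' (by positivity)]

theorem iSup_toReal_pos (X : PMF (Fin n → Bool)) : 0 < ⨆ x, (X x).toReal :=
  (by positivity : (0 : ℝ) < ((2 : ℝ) ^ n)⁻¹).trans_le (inv_two_pow_le_iSup X)

theorem minEntropy_le (X : PMF (Fin n → Bool)) : minEntropy X ≤ n := by
  rw [minEntropy, neg_le, Real.le_logb_iff_rpow_le one_lt_two (iSup_toReal_pos X),
    Real.rpow_neg two_pos.le, Real.rpow_natCast]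
  exact inv_two_pow_le_iSup X

theorem le_minEntropy_iff (X : PMF (Fin n → Bool)) (k : ℝ) :
    k ≤ minEntropy X ↔ ∀ x, (X x).toReal ≤ (2 : ℝ) ^ (-k) := by
  rw [minEntropy, le_neg, Real.logb_le_iff_le_rpow one_lt_two (iSup_toReal_pos X)]
  exact ciSup_le_iff (Set.finite_range _).bddAbove

theorem minEntropy_nonneg (X : PMF (Fin n → Bool)) : 0 ≤ minEntropy X := by
  rw [le_minEntropy_iff]
  intro x
  simpa using ENNReal.toReal_mono ENNReal.one_ne_top (X.coe_le_one x)

theorem minEntropy_le_smoothMinEntropy {δ : ℝ} {X Y : PMF (Fin n → Bool)} (h : d1 X Y ≤ δ) :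
    minEntropy Y ≤ smoothMinEntropy δ X := by
  refine le_csSup ⟨n, ?_⟩ ⟨Y, h, rfl⟩
  rintro _ ⟨Z, -, rfl⟩
  exact minEntropy_le Z

theorem exists_pmf_toReal_eq (p : (Fin n → Bool) → ℝ) (hp : ∀ x, 0 ≤ p x)
    (h1 : ∑ x, p x = 1) : ∃ Z : PMF (Fin n → Bool), ∀ x, (Z x).toReal = p x := by
  refine ⟨PMF.ofFintype (fun x => ENNReal.ofReal (p x)) ?_, fun x => ?_⟩
  · rw [← ENNReal.ofReal_sum_of_nonneg fun x _ => hp x, h1, ENNReal.ofReal_one]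
  · rw [PMF.ofFintype_apply, ENNReal.toReal_ofReal (hp x)]

/-- Truncating `X` at height `θ` and spreading the excess evenly over the remaining room. -/
theorem exists_pmf_le_and_d1_le {X Y : PMF (Fin n → Bool)} {θ : ℝ} (hθ : 0 < θ)
    (hY : ∀ x, (Y x).toReal ≤ θ) :
    ∃ Z : PMF (Fin n → Bool), (∀ x, (Z x).toReal ≤ θ) ∧
      d1 X Z ≤ 2 * ∑ x, ((X x).toReal - min (X x).toReal θ) := by
  set μ : (Fin n → Bool) → ℝ := fun x => min (X x).toReal θ with hμ
  set e := ∑ x, ((X x).toReal - μ x) with he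
  set R := ∑ x, (θ - μ x) with hR
  have hμX : ∀ x, μ x ≤ (X x).toReal := fun x => min_le_left _ _
  have hμθ : ∀ x, μ x ≤ θ := fun x => min_le_right _ _
  have hμ0 : ∀ x, 0 ≤ μ x := fun x => le_min ENNReal.toReal_nonneg hθ.le
  have he0 : 0 ≤ e := Finset.sum_nonneg fun x _ => sub_nonneg.2 (hμX x)
  have heμ : e = 1 - ∑ x, μ x := by
    rw [he, Finset.sum_sub_distrib, sum_toReal_eq_one]
  -- The room suffices because `Y`, of total mass `1`, fits below `θ`.
  have heR : e ≤ R := by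
    rw [heμ, ← sum_toReal_eq_one Y, ← Finset.sum_sub_distrib]
    exact Finset.sum_le_sum fun x _ => sub_le_sub_right (hY x) _
  have hlR : e / R * R = e := by
    -- No room means no excess, so the value `e / 0 = 0` is harmless.
    rcases eq_or_ne R 0 with h | h
    · rw [h] at heR ⊢
      simp [le_antisymm heR he0]
    · exact div_mul_cancel₀ _ h
  have hl0 : 0 ≤ e / R := div_nonneg he0 (he0.trans heR)
  have hl1 : e / R ≤ 1 := div_le_one_of_le₀ heR (he0.trans heR)
  obtain ⟨Z, hZ⟩ := exists_pmf_toReal_eq (fun x => μ x + e / R * (θ - μ x))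
    (fun x => add_nonneg (hμ0 x) (mul_nonneg hl0 (sub_nonneg.2 (hμθ x)))) (by
      rw [Finset.sum_add_distrib, ← Finset.mul_sum, hlR, heμ]
      ring)
  refine ⟨Z, fun x => ?_, ?_⟩
  · rw [hZ]
    nlinarith [mul_le_mul_of_nonneg_right hl1 (sub_nonneg.2 (hμθ x))]
  · calc d1 X Z ≤ ∑ x, (((X x).toReal - μ x) + e / R * (θ - μ x)) := by
          refine Finset.sum_le_sum fun x _ => ?_
          have h₁ := mul_nonneg hl0 (sub_nonneg.2 (hμθ x))
          have h₂ := hμX x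
          rw [hZ, abs_le]
          constructor <;> linarith
      _ = 2 * e := by
          rw [Finset.sum_add_distrib, ← Finset.mul_sum, hlR]
          ring

/-- The part of `X` above height `2 ^ (-k)` is heavy if the smooth min-entropy is below `k`. -/
theorem lt_sum_toReal_sub_toReal {X Y : PMF (Fin n → Bool)} {k δ : ℝ}
    (hX : smoothMinEntropy δ X < k) (hY : k ≤ minEntropy Y) :
    δ / 2 < ∑ x with (2 : ℝ) ^ (-k) < (X x).toReal, ((X x).toReal - (Y x).toReal) := by
  rw [le_minEntropy_iff] at hY
  obtain ⟨Z, hZ, hd⟩ := exists_pmf_le_and_d1_le (X := X) (by positivity) hY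
  have hlt : δ < d1 X Z := by
    by_contra! h
    exact absurd ((le_minEntropy_iff Z k).2 hZ)
      (not_le.2 ((minEntropy_le_smoothMinEntropy h).trans_lt hX))
  have hle : ∑ x, ((X x).toReal - min (X x).toReal ((2 : ℝ) ^ (-k))) ≤
      ∑ x with (2 : ℝ) ^ (-k) < (X x).toReal, ((X x).toReal - (Y x).toReal) := by
    rw [Finset.sum_filter]
    refine Finset.sum_le_sum fun x _ => ?_
    split_ifs with h
    · rw [min_eq_right h.le]
      linarith [hY x]
    · rw [min_eq_left (not_lt.1 h), sub_self]
  linarith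

theorem card_filter_lt_toReal_le (X : PMF (Fin n → Bool)) (k : ℝ) :
    ((Finset.univ.filter fun x => (2 : ℝ) ^ (-k) < (X x).toReal).card : ℝ) ≤ (2 : ℝ) ^ k := by
  set S := Finset.univ.filter fun x => (2 : ℝ) ^ (-k) < (X x).toReal with hS
  have h : (S.card : ℝ) * (2 : ℝ) ^ (-k) ≤ 1 := by
    rw [← nsmul_eq_mul, ← sum_toReal_eq_one X]
    refine (Finset.card_nsmul_le_sum S (fun x => (X x).toReal) _ fun x hx => ?_).trans
      (Finset.sum_le_sum_of_subset_of_nonneg (Finset.subset_univ S)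
        fun x _ _ => ENNReal.toReal_nonneg)
    exact (Finset.mem_filter.1 hx).2.le
  rwa [Real.rpow_neg two_pos.le, ← div_eq_mul_inv, div_le_one (by positivity)] at h

/-! ### Distinguishers and the final bounds -/

theorem acceptProb_sub_acceptProb (D : Circuit n) (X Y : PMF (Fin n → Bool)) :
    acceptProb D X - acceptProb D Y =
      ∑ x with D.eval x = true, ((X x).toReal - (Y x).toReal) := by
  rw [acceptProb, acceptProb, Finset.sum_filter, ← Finset.sum_sub_distrib]
  refine Finset.sum_congr rfl fun x _ => ?_
  split_ifs <;> simp

/-- `P_X - P_Y` sums to `0`, so replacing a `0/1` test by its `±1` version exactly doubles the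
correlation. -/
theorem two_mul_acceptProb_sub_acceptProb (D : Circuit n) (X Y : PMF (Fin n → Bool)) :
    2 * (acceptProb D X - acceptProb D Y) =
      ∑ x, ((X x).toReal - (Y x).toReal) * sign (D.eval x) := by
  have h0 : ∑ x, ((X x).toReal - (Y x).toReal) = 0 := by
    rw [Finset.sum_sub_distrib, sum_toReal_eq_one, sum_toReal_eq_one, sub_self]
  have h : ∀ x, ((X x).toReal - (Y x).toReal) * sign (D.eval x) =
      2 * (if D.eval x = true then (X x).toReal - (Y x).toReal else 0) -
        ((X x).toReal - (Y x).toReal) := fun x => by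
    cases D.eval x <;> simp [sign]
    ring
  rw [acceptProb_sub_acceptProb, Finset.sum_filter, Finset.sum_congr rfl fun x _ => h x,
    Finset.sum_sub_distrib, h0, sub_zero, Finset.mul_sum]

/-- The indicator of the heavy part of `X` as a distinguisher. -/
theorem exists_circuit_lt_advantage_of_lt_four_mul (hn : 1 ≤ n) {X Y : PMF (Fin n → Bool)}
    {k δ ε : ℝ} (hδ : 0 < δ) (hεδ : ε ≤ δ / 2) (hδε : δ < 4 * ε)
    (hX : smoothMinEntropy δ X < k) (hY : k ≤ minEntropy Y) :
    ∃ D : Circuit n, (D.size : ℝ) ≤ 500 * n * max 1 ((2 : ℝ) ^ k * ε ^ 2 / δ ^ 2) ∧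
      ε < advantage D X Y := by
  have hsum := lt_sum_toReal_sub_toReal hX hY
  have hcard := card_filter_lt_toReal_le X k
  set S := Finset.univ.filter fun x => (2 : ℝ) ^ (-k) < (X x).toReal with hS
  obtain ⟨D, hD, hDS⟩ := (costFrom_decide_mem S).exists_circuit
  refine ⟨D, ?_, ?_⟩
  · set M := max 1 ((2 : ℝ) ^ k * ε ^ 2 / δ ^ 2) with hM
    have hM1 : 1 ≤ M := le_max_left _ _
    have hSM : (S.card : ℝ) ≤ 16 * M := by
      have h : (2 : ℝ) ^ k * ε ^ 2 / δ ^ 2 ≤ M := le_max_right _ _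
      rw [div_le_iff₀ (by positivity)] at h
      have hsq : δ ^ 2 ≤ 16 * ε ^ 2 := by nlinarith
      have hk : (0 : ℝ) < (2 : ℝ) ^ k := by positivity
      refine hcard.trans (le_of_mul_le_mul_right (a := δ ^ 2) ?_ (by positivity))
      nlinarith
    have hn' : (1 : ℝ) ≤ n := by exact_mod_cast hn
    have hD' : (D.size : ℝ) ≤ S.card * (2 * n + 2) + 1 := by exact_mod_cast hD
    have h₁ : (S.card : ℝ) * (2 * n + 2) ≤ 16 * M * (2 * n + 2) := by gcongr
    nlinarith
  · rw [advantage, acceptProb_sub_acceptProb, hDS]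
    simp only [decide_eq_true_eq, Finset.filter_univ_mem]
    exact (hεδ.trans_lt hsum).trans_le (le_abs_self _)

/-- A decision list of signed characters as a distinguisher. -/
theorem exists_circuit_lt_advantage_of_four_mul_le (hn : 1 ≤ n) {X Y : PMF (Fin n → Bool)}
    {k δ ε : ℝ} (hε : 0 < ε) (hδε : 4 * ε ≤ δ)
    (hX : smoothMinEntropy δ X < k) (hY : k ≤ minEntropy Y) :
    ∃ D : Circuit n, (D.size : ℝ) ≤ 500 * n * max 1 ((2 : ℝ) ^ k * ε ^ 2 / δ ^ 2) ∧
      ε < advantage D X Y := by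
  have hδ : 0 < δ := by linarith
  have hsum := lt_sum_toReal_sub_toReal hX hY
  have hcard := card_filter_lt_toReal_le X k
  set S := Finset.univ.filter fun x => (2 : ℝ) ^ (-k) < (X x).toReal with hS
  -- Chosen so that `(δ / 2) / √ρ = 2 * ε`; rounding down to `q` preserves this bound and at most
  -- doubles the block count.
  set ρ := (δ / (4 * ε)) ^ 2 with hρ
  have hρ1 : 1 ≤ ρ := one_le_pow₀ ((one_le_div (by positivity)).2 hδε)
  set q := ⌊ρ⌋₊ with hq
  have hq1 : 1 ≤ q := Nat.le_floor (by exact_mod_cast hρ1)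
  have hq1' : (1 : ℝ) ≤ q := by exact_mod_cast hq1
  have hqρ : (q : ℝ) ≤ ρ := Nat.floor_le (by positivity)
  have hρq : ρ ≤ 2 * q := by linarith [Nat.lt_floor_add_one ρ]
  set m := ⌈(S.card : ℝ) / q⌉₊ with hm
  have hSm : S.card ≤ m * q := by
    have := Nat.le_ceil ((S.card : ℝ) / q)
    rw [div_le_iff₀ (by positivity)] at this
    exact_mod_cast this
  obtain ⟨f, hf, hfD⟩ := exists_costFrom_sum_div_sqrt_le_of_card_le_mul hq1 m
    (fun x => (X x).toReal - (Y x).toReal) S hSm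
  obtain ⟨D, hD, rfl⟩ := hf.exists_circuit
  refine ⟨D, ?_, ?_⟩
  · set M := max 1 ((2 : ℝ) ^ k * ε ^ 2 / δ ^ 2) with hM
    have hM1 : 1 ≤ M := le_max_left _ _
    -- `16` comes from the `4` in `ρ`, and a factor `2` from the floor.
    have hSM : (S.card : ℝ) / q ≤ 32 * M := by
      rw [div_le_iff₀ (by positivity)]
      have h : (2 : ℝ) ^ k ≤ M * (16 * ρ) := by
        have h : (2 : ℝ) ^ k * ε ^ 2 / δ ^ 2 ≤ M := le_max_right _ _
        have h' : (2 : ℝ) ^ k = (2 : ℝ) ^ k * ε ^ 2 / δ ^ 2 * (16 * ρ) := by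
          rw [hρ]
          field_simp
          norm_num
        rw [h']
        gcongr
      nlinarith
    have hmM : (m : ℝ) ≤ 33 * M := by
      have := Nat.ceil_lt_add_one (by positivity : 0 ≤ (S.card : ℝ) / q)
      linarith
    have hn' : (1 : ℝ) ≤ n := by exact_mod_cast hn
    have hD' : (D.size : ℝ) ≤ m * (6 * n + 6) + 1 := by exact_mod_cast hD
    have h₁ : (m : ℝ) * (6 * n + 6) ≤ 33 * M * (6 * n + 6) := by gcongr
    nlinarith
  · rw [← two_mul_acceptProb_sub_acceptProb] at hfD
    have hsq : √(q : ℝ) ≤ δ / (4 * ε) := Real.sqrt_le_left (by positivity) |>.2 hqρ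
    have hlt : 2 * ε < (∑ x ∈ S, ((X x).toReal - (Y x).toReal)) / √q := by
      rw [lt_div_iff₀ (by positivity)]
      refine lt_of_le_of_lt ?_ hsum
      calc 2 * ε * √q ≤ 2 * ε * (δ / (4 * ε)) := by gcongr
        _ = δ / 2 := by
          field_simp
          norm_num
    rw [advantage]
    refine lt_of_lt_of_le ?_ (le_abs_self _)
    linarith

theorem exists_circuit_lt_advantage {X Y : PMF (Fin n → Bool)} {k δ ε : ℝ} (hδ : 0 < δ)
    (hε : 0 < ε) (hεδ : ε ≤ δ / 2) (hX : smoothMinEntropy δ X < k) (hY : k ≤ minEntropy Y) :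
    ∃ D : Circuit n, (D.size : ℝ) ≤ 500 * n * max 1 ((2 : ℝ) ^ k * ε ^ 2 / δ ^ 2) ∧
      ε < advantage D X Y := by
  -- For `n = 0` the size bound is `0`, but then all min-entropies vanish and `hX`, `hY` contradict
  -- each other.
  have hn : 1 ≤ n := by
    have h0 : minEntropy X ≤ smoothMinEntropy δ X :=
      minEntropy_le_smoothMinEntropy (by simpa [d1] using hδ.le)
    have h : (0 : ℝ) < n := by linarith [minEntropy_nonneg X, minEntropy_le Y]
    exact_mod_cast h
  rcases le_or_gt (4 * ε) δ with h | h
  · exact exists_circuit_lt_advantage_of_four_mul_le hn hε h hX hY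
  · exact exists_circuit_lt_advantage_of_lt_four_mul hn hδ hεδ h hX hY

theorem hillEntropy_lt {X : PMF (Fin n → Bool)} {k δ ε : ℝ} (hδ : 0 < δ) (hε : 0 < ε)
    (hεδ : ε ≤ δ / 2) (hX : smoothMinEntropy δ X < k) :
    hillEntropy (500 * n * max 1 ((2 : ℝ) ^ k * ε ^ 2 / δ ^ 2)) ε X < k := by
  -- Bounding every candidate below `k` would only give a supremum `≤ k`. Working at `k' < k` makes
  -- it strict, and the size bound is monotone in `k`.
  obtain ⟨k', hk', hkk'⟩ := exists_between hX
  refine lt_of_le_of_lt (csSup_le ⟨_, X, ?_, rfl⟩ ?_) hkk'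
  · intro D _
    simpa [advantage] using hε.le
  · rintro _ ⟨Y, hY, rfl⟩
    by_contra! h
    obtain ⟨D, hD, hadv⟩ := exists_circuit_lt_advantage hδ hε hεδ hk' h.le
    refine absurd (hY D (hD.trans ?_)) (not_le.2 hadv)
    gcongr
    exact one_le_two

end Pseudoentropy

theorem lemma1 :
    ∃ C : ℝ, 0 < C ∧
      ∀ (n : ℕ) (X : PMF (Fin n → Bool)) (k δ ε : ℝ),
        0 < δ → 0 < ε → ε ≤ δ / 2 →
        Pseudoentropy.smoothMinEntropy δ X < k →
        Pseudoentropy.hillEntropy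
            (C * n * max 1 ((2 : ℝ) ^ k * ε ^ 2 / δ ^ 2)) ε X < k ∧
        ∀ Y : PMF (Fin n → Bool), k ≤ Pseudoentropy.minEntropy Y →
          ∃ D : Pseudoentropy.Circuit n,
            (D.size : ℝ) ≤ C * n * max 1 ((2 : ℝ) ^ k * ε ^ 2 / δ ^ 2) ∧
            ε < Pseudoentropy.advantage D X Y :=
  ⟨500, by norm_num, fun _ _ _ _ _ hδ hε hεδ hX =>
    ⟨Pseudoentropy.hillEntropy_lt hδ hε hεδ hX,
      fun _ hY => Pseudoentropy.exists_circuit_lt_advantage hδ hε hεδ hX hY⟩⟩
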